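/- There are absolute constants $c, c''>0$ such that the following holds. For all real $0<r<\rho$ there is a constant $\eta>0$, depending only on $r$ and $\rho$, with \[ \eta\le c''\,\frac{\rho^4}{(\rho-r)^4}\,\max\Big\{1,\ \ln\frac{\rho}{\rho-r}\Big\}, \] such that: if $\varphi$ is analytic and bounded in the disk $D(0,\rho)=\{z\in\mathbb{C}:|z|<\rho\}$, $M=\sup_{|z|<\rho}|\varphi(z)|$ (which equals $\max_{|z|\le\rho}|\varphi(z)|$ when $\varphi$ is continuous on the closed disk), $E\subset D(0,r)$ is a Lebesgue measurable set of positive planar Lebesgue measure $|E|$, and $|\varphi(z_0)|\ge 1$ for some $z_0\in D(0,r)$, then \[ \sup_{z\in D(0,r)}|\varphi(z)|\le\Big(\frac{c\,r^2}{|E|}\Big)^{\eta\ln M}\ \sup_{z\in E}|\varphi(z)|. \] -/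

import Mathlib

open Metric Set MeasureTheory
open scoped ENNReal

/-! Write φ = B·g, with B the Blaschke product over the zeros in |w| ≤ (r+ρ)/2 and g zero-free
there, |g| ≤ M. Each factor at z₀ is below 1 by a definite amount, so |φ(z₀)| ≥ 1 allows at most N =
16(ρ/(ρ-r))² ln M of them. Since |g(z₀)| ≥ 1 too, Harnack applied to ln M - ln|g| gives |g| ≥ M
e^{-N} on D(0,r).

B may be tiny near its zeros, but not on all of E: with |E| = πs², averaging Σ s/|z-w_j| over E
finds z in E with sum at most 3n, whence |B(z)| ≥ exp(-N(2+ln(4r/s))) when ρ ≤ 2r. So M, which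
bounds the supremum over D(0,r), is controlled by |φ(z)|. Replacing ρ by min(ρ, 2r) makes the base
scale as r²/|E|. -/

/-! ### Estimates for Blaschke factors -/

/-- The Blaschke factor of the disk of radius `ρ` vanishing at `w`. -/
noncomputable def blaschkeFactor (ρ : ℝ) (w z : ℂ) : ℂ :=
  ρ * (z - w) / (ρ ^ 2 - starRingEnd ℂ w * z)

lemma norm_sq_blaschke_denom_sub (ρ : ℝ) (w z : ℂ) :
    ‖(ρ : ℂ) ^ 2 - starRingEnd ℂ w * z‖ ^ 2 - ‖(ρ : ℂ) * (z - w)‖ ^ 2 =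
      (ρ ^ 2 - ‖z‖ ^ 2) * (ρ ^ 2 - ‖w‖ ^ 2) := by
  simp only [← Complex.normSq_eq_norm_sq]
  simp only [Complex.normSq_apply, Complex.sub_re, Complex.sub_im, Complex.mul_re, Complex.mul_im, Complex.conj_re, Complex.conj_im, Complex.ofReal_re,
    Complex.ofReal_im, pow_two]
  ring

lemma norm_blaschke_denom_ge {ρ : ℝ} {w z : ℂ} (hz : ‖z‖ ≤ ρ) :
    ρ * (ρ - ‖w‖) ≤ ‖(ρ : ℂ) ^ 2 - starRingEnd ℂ w * z‖ := by
  have h := norm_sub_norm_le ((ρ : ℂ) ^ 2) (starRingEnd ℂ w * z)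
  simp only [norm_pow, Complex.norm_real, norm_mul, RCLike.norm_conj, Real.norm_eq_abs,
    sq_abs] at h
  nlinarith [norm_nonneg w]

lemma norm_blaschke_denom_le {ρ : ℝ} {w z : ℂ} (hw : ‖w‖ ≤ ρ) (hz : ‖z‖ ≤ ρ) :
    ‖(ρ : ℂ) ^ 2 - starRingEnd ℂ w * z‖ ≤ 2 * ρ ^ 2 := by
  have h := norm_sub_le ((ρ : ℂ) ^ 2) (starRingEnd ℂ w * z)
  simp only [norm_pow, Complex.norm_real, norm_mul, RCLike.norm_conj, Real.norm_eq_abs,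
    sq_abs] at h
  nlinarith [norm_nonneg w, norm_nonneg z]

lemma blaschke_denom_norm_pos {ρ : ℝ} {w z : ℂ} (hw : ‖w‖ < ρ) (hz : ‖z‖ ≤ ρ) :
    0 < ‖(ρ : ℂ) ^ 2 - starRingEnd ℂ w * z‖ :=
  (mul_pos ((norm_nonneg w).trans_lt hw) (sub_pos.2 hw)).trans_le (norm_blaschke_denom_ge hz)

lemma norm_sq_blaschkeFactor {ρ : ℝ} {w z : ℂ} (hw : ‖w‖ < ρ) (hz : ‖z‖ ≤ ρ) :
    ‖blaschkeFactor ρ w z‖ ^ 2 = 1 - (ρ ^ 2 - ‖z‖ ^ 2) * (ρ ^ 2 - ‖w‖ ^ 2) /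
      ‖(ρ : ℂ) ^ 2 - starRingEnd ℂ w * z‖ ^ 2 := by
  have h := blaschke_denom_norm_pos hw hz
  rw [blaschkeFactor, norm_div, div_pow, ← norm_sq_blaschke_denom_sub, sub_div,
    div_self (by positivity), sub_sub_cancel]

lemma norm_sub_div_le_norm_blaschkeFactor {ρ : ℝ} {w z : ℂ} (hw : ‖w‖ < ρ) (hz : ‖z‖ ≤ ρ) :
    ‖z - w‖ / (2 * ρ) ≤ ‖blaschkeFactor ρ w z‖ := by
  have hρ : 0 < ρ := (norm_nonneg w).trans_lt hw
  have h := blaschke_denom_norm_pos hw hz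
  have h2 := norm_blaschke_denom_le hw.le hz
  rw [blaschkeFactor, norm_div, norm_mul, Complex.norm_real, Real.norm_of_nonneg hρ.le,
    div_le_div_iff₀ (by positivity) h]
  nlinarith [norm_nonneg (z - w), mul_le_mul_of_nonneg_left h2 (norm_nonneg (z - w))]

/-- The deficit 1 - |b|² is at least (ρ-r)²/(8ρ²), and 1 - x ≤ e^{-x}. This is the price of each
zero when zeros are counted at z₀. -/
lemma norm_blaschkeFactor_le_exp {r ρ : ℝ} {w z : ℂ} (hr : 0 < r) (hrρ : r < ρ)
    (hw : ‖w‖ ≤ (r + ρ) / 2) (hz : ‖z‖ ≤ r) :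
    ‖blaschkeFactor ρ w z‖ ≤ Real.exp (-((ρ - r) ^ 2 / (16 * ρ ^ 2))) := by
  have hρ : 0 < ρ := hr.trans hrρ
  have hwρ : ‖w‖ < ρ := by linarith
  have hd := blaschke_denom_norm_pos hwρ (hz.trans hrρ.le)
  have hd2 := norm_blaschke_denom_le hwρ.le (hz.trans hrρ.le)
  have hz' : ρ * (ρ - r) ≤ ρ ^ 2 - ‖z‖ ^ 2 := by nlinarith [norm_nonneg z]
  have hw' : ρ * (ρ - r) / 2 ≤ ρ ^ 2 - ‖w‖ ^ 2 := by nlinarith [norm_nonneg w]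
  have hρr : 0 < ρ * (ρ - r) := mul_pos hρ (sub_pos.2 hrρ)
  have key : (ρ - r) ^ 2 / (8 * ρ ^ 2) ≤ (ρ ^ 2 - ‖z‖ ^ 2) * (ρ ^ 2 - ‖w‖ ^ 2) /
      ‖(ρ : ℂ) ^ 2 - starRingEnd ℂ w * z‖ ^ 2 := by
    calc (ρ - r) ^ 2 / (8 * ρ ^ 2)
        = (ρ * (ρ - r)) * (ρ * (ρ - r) / 2) / (2 * ρ ^ 2) ^ 2 := by field_simp; ring
      _ ≤ _ := by
        have h1 := hρr.le.trans hz'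
        have h2 := (half_pos hρr).le.trans hw'
        have h3 := mul_nonneg h1 h2
        gcongr
  refine le_of_sq_le_sq ?_ (Real.exp_pos _).le
  rw [norm_sq_blaschkeFactor hwρ (hz.trans hrρ.le), ← Real.exp_nat_mul]
  have := Real.add_one_le_exp (-((ρ - r) ^ 2 / (8 * ρ ^ 2)))
  have e : ((2 : ℕ) : ℝ) * -((ρ - r) ^ 2 / (16 * ρ ^ 2)) = -((ρ - r) ^ 2 / (8 * ρ ^ 2)) := by
    push_cast; field_simp; ring
  rw [e]
  linarith

/-! ### Dividing out zeros -/

/-- A holomorphic function bounded by `M` on a disk and vanishing at `w` is the product of the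
Blaschke factor at `w` and a holomorphic function with the same bound. -/
lemma exists_eq_blaschkeFactor_mul {ρ M : ℝ} {w : ℂ} {g : ℂ → ℂ} (hw : ‖w‖ < ρ)
    (hg : DifferentiableOn ℂ g (ball 0 ρ)) (hM : ∀ z ∈ ball (0 : ℂ) ρ, ‖g z‖ ≤ M)
    (hgw : g w = 0) :
    ∃ h : ℂ → ℂ, DifferentiableOn ℂ h (ball 0 ρ) ∧ (∀ z ∈ ball (0 : ℂ) ρ, ‖h z‖ ≤ M) ∧
      ∀ z ∈ ball (0 : ℂ) ρ, g z = blaschkeFactor ρ w z * h z := by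
  have hρ : 0 < ρ := (norm_nonneg w).trans_lt hw
  set h : ℂ → ℂ := fun z => dslope g w z * (ρ ^ 2 - starRingEnd ℂ w * z) / ρ with hh
  have hds : DifferentiableOn ℂ (dslope g w) (ball 0 ρ) :=
    (Complex.differentiableOn_dslope (isOpen_ball.mem_nhds (by simpa using hw))).2 hg
  have hhd : DifferentiableOn ℂ h (ball 0 ρ) :=
    (hds.mul (by fun_prop)).div_const _
  have heq : ∀ z ∈ ball (0 : ℂ) ρ, g z = blaschkeFactor ρ w z * h z := by
    intro z hz
    have hz' : ‖z‖ < ρ := by simpa using hz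
    have hd : (ρ : ℂ) ^ 2 - starRingEnd ℂ w * z ≠ 0 :=
      norm_pos_iff.1 (blaschke_denom_norm_pos hw hz'.le)
    have hρc : (ρ : ℂ) ≠ 0 := by exact_mod_cast hρ.ne'
    have h1 : (z - w) * dslope g w z = g z := by
      simpa [hgw] using sub_smul_dslope g w z
    rw [← h1, hh, blaschkeFactor]
    beta_reduce
    generalize (ρ : ℂ) ^ 2 - starRingEnd ℂ w * z = d at hd ⊢
    field_simp
  refine ⟨h, hhd, fun z hz => ?_, heq⟩
  have hz' : ‖z‖ < ρ := by simpa using hz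
  have hM0 : 0 ≤ M := (norm_nonneg _).trans (hM z hz)
  -- Nothing is known on |z| = ρ, so the maximum principle is used on circles |ζ| = t < ρ. There
  -- |b|² ≥ 1 - (ρ² - t²)κ tends to 1, which suffices for any C > M.
  refine le_of_forall_gt_imp_ge_of_dense fun C hC => ?_
  have hC0 : 0 < C := hM0.trans_lt hC
  set κ : ℝ := (ρ ^ 2 - ‖w‖ ^ 2) / (ρ * (ρ - ‖w‖)) ^ 2 with hκ
  have hcont : Filter.Tendsto (fun t : ℝ => C ^ 2 * (1 - (ρ ^ 2 - t ^ 2) * κ))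
      (nhdsWithin ρ (Iio ρ)) (nhds (C ^ 2 * (1 - (ρ ^ 2 - ρ ^ 2) * κ))) :=
    ((by fun_prop : Continuous fun t : ℝ => C ^ 2 * (1 - (ρ ^ 2 - t ^ 2) * κ)).tendsto
      ρ).mono_left nhdsWithin_le_nhds
  have hev := hcont.eventually_const_lt (u := M ^ 2) (by
    rw [sub_self, zero_mul, sub_zero, mul_one]; gcongr)
  have hev2 : ∀ᶠ t in nhdsWithin ρ (Iio ρ), t ∈ Ioo ‖z‖ ρ := Ioo_mem_nhdsLT hz'
  obtain ⟨t, ht1, ht2, ht3⟩ := (hev.and hev2).exists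
  have ht0 : 0 < t := (norm_nonneg z).trans_lt ht2
  have hsub : closedBall (0 : ℂ) t ⊆ ball 0 ρ := closedBall_subset_ball ht3
  refine Complex.norm_le_of_forall_mem_frontier_norm_le (U := ball (0 : ℂ) t) isBounded_ball
    (hhd.diffContOnCl_ball hsub) ?_ (subset_closure (by simpa using ht2))
  intro ζ hζ
  rw [frontier_ball _ ht0.ne'] at hζ
  have hζt : ‖ζ‖ = t := by simpa using hζ
  have hζρ : ζ ∈ ball (0 : ℂ) ρ := by simpa [hζt] using ht3
  have hζle : ‖ζ‖ ≤ ρ := by linarith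
  have hb : 1 - (ρ ^ 2 - t ^ 2) * κ ≤ ‖blaschkeFactor ρ w ζ‖ ^ 2 := by
    rw [norm_sq_blaschkeFactor hw hζle, hκ, hζt, ← mul_div_assoc]
    have h1 : 0 ≤ ρ ^ 2 - t ^ 2 := by nlinarith
    have h2 : 0 ≤ ρ ^ 2 - ‖w‖ ^ 2 := by nlinarith [norm_nonneg w]
    have h3 : 0 < ρ * (ρ - ‖w‖) := mul_pos hρ (sub_pos.2 hw)
    gcongr
    exact norm_blaschke_denom_ge hζle
  have hgM := hM ζ hζρ
  rw [heq ζ hζρ, norm_mul] at hgM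
  by_contra! hlt
  have hb' : C ^ 2 * (1 - (ρ ^ 2 - t ^ 2) * κ) ≤ ‖blaschkeFactor ρ w ζ‖ ^ 2 * ‖h ζ‖ ^ 2 := by
    calc _ ≤ C ^ 2 * ‖blaschkeFactor ρ w ζ‖ ^ 2 := by gcongr
      _ ≤ ‖h ζ‖ ^ 2 * ‖blaschkeFactor ρ w ζ‖ ^ 2 := by gcongr
      _ = _ := mul_comm _ _
  have : (‖blaschkeFactor ρ w ζ‖ * ‖h ζ‖) ^ 2 ≤ M ^ 2 := by gcongr
  nlinarith

/-- A bounded holomorphic function on a disk factors into finitely many Blaschke factors and a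
function with the same bound and no zeros in a smaller disk. -/
lemma exists_blaschke_factorization {r ρ M : ℝ} {φ : ℂ → ℂ} {z₀ : ℂ} (hr : 0 < r) (hrρ : r < ρ)
    (hφ : DifferentiableOn ℂ φ (ball 0 ρ)) (hM : ∀ z ∈ ball (0 : ℂ) ρ, ‖φ z‖ ≤ M)
    (hz₀ : ‖z₀‖ < r) (h₀ : 1 ≤ ‖φ z₀‖) :
    ∃ (n : ℕ) (w : Fin n → ℂ) (g : ℂ → ℂ), (n : ℝ) ≤ 16 * (ρ / (ρ - r)) ^ 2 * Real.log M ∧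
      (∀ j, ‖w j‖ ≤ (r + ρ) / 2) ∧ DifferentiableOn ℂ g (ball 0 ρ) ∧
      (∀ z ∈ ball (0 : ℂ) ρ, ‖g z‖ ≤ M) ∧
      (∀ z ∈ ball (0 : ℂ) ρ, φ z = (∏ j, blaschkeFactor ρ (w j) z) * g z) ∧
      (∀ z, ‖z‖ ≤ (r + ρ) / 2 → g z ≠ 0) := by
  have hρ : 0 < ρ := hr.trans hrρ
  have hd : 0 < ρ - r := sub_pos.2 hrρ
  have hz₀ρ : z₀ ∈ ball (0 : ℂ) ρ := by simpa using hz₀.trans hrρ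
  have hM1 : 1 ≤ M := h₀.trans (hM z₀ hz₀ρ)
  let P : ℕ → Prop := fun n => ∃ (w : Fin n → ℂ) (g : ℂ → ℂ), (∀ j, ‖w j‖ ≤ (r + ρ) / 2) ∧
    DifferentiableOn ℂ g (ball 0 ρ) ∧ (∀ z ∈ ball (0 : ℂ) ρ, ‖g z‖ ≤ M) ∧
    (∀ z ∈ ball (0 : ℂ) ρ, φ z = (∏ j, blaschkeFactor ρ (w j) z) * g z)
  have hbound : ∀ n, P n → (n : ℝ) ≤ 16 * (ρ / (ρ - r)) ^ 2 * Real.log M := by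
    rintro n ⟨w, g, hw, -, hgM, heq⟩
    have h1 : 1 ≤ Real.exp (-((ρ - r) ^ 2 / (16 * ρ ^ 2))) ^ n * M := by
      calc 1 ≤ ‖φ z₀‖ := h₀
        _ = (∏ j, ‖blaschkeFactor ρ (w j) z₀‖) * ‖g z₀‖ := by
          rw [heq z₀ hz₀ρ, norm_mul, norm_prod]
        _ ≤ (∏ _j : Fin n, Real.exp (-((ρ - r) ^ 2 / (16 * ρ ^ 2)))) * M := by
          gcongr with j
          · exact norm_blaschkeFactor_le_exp hr hrρ (hw j) hz₀.le
          · exact hgM z₀ hz₀ρ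
        _ = _ := by simp
    have h2 := Real.log_le_log one_pos h1
    rw [Real.log_one, Real.log_mul (by positivity) (by positivity), Real.log_pow,
      Real.log_exp] at h2
    have h3 : (n : ℝ) * ((ρ - r) ^ 2 / (16 * ρ ^ 2)) ≤ Real.log M := by linarith
    calc (n : ℝ) = 16 * (ρ / (ρ - r)) ^ 2 * (n * ((ρ - r) ^ 2 / (16 * ρ ^ 2))) := by
          field_simp
      _ ≤ _ := by gcongr
  have h0 : P 0 := ⟨Fin.elim0, φ, fun j => j.elim0, hφ, hM, by simp⟩
  -- Take n after which no further factor can be extracted; a remaining zero of g would contradict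
  -- this.
  obtain ⟨n, hn, hn'⟩ : ∃ n, P n ∧ ¬ P (n + 1) := by
    by_contra! hall
    obtain ⟨k, hk⟩ := exists_nat_gt (16 * (ρ / (ρ - r)) ^ 2 * Real.log M)
    exact hk.not_ge (hbound k (Nat.rec h0 hall k))
  obtain ⟨w, g, hw, hg, hgM, heq⟩ := hn
  refine ⟨n, w, g, hbound n ⟨w, g, hw, hg, hgM, heq⟩, hw, hg, hgM, heq, fun v hv hgv => hn' ?_⟩
  obtain ⟨h, hh, hhM, hheq⟩ := exists_eq_blaschkeFactor_mul (by linarith) hg hgM hgv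
  refine ⟨Fin.snoc w v, h, fun j => ?_, hh, hhM, fun z hz => ?_⟩
  · refine Fin.lastCases ?_ (fun i => ?_) j
    · simpa using hv
    · simpa using hw i
  · rw [heq z hz, hheq z hz, Fin.prod_univ_castSucc]
    simp [mul_assoc]

/-! ### Harnack and the zero-free factor -/

/-- **Harnack's inequality** relative to the center, for the real part of a holomorphic function. -/
lemma harnack_re {R : ℝ} {f : ℂ → ℂ} {z : ℂ} (hf : DifferentiableOn ℂ f (ball 0 R))
    (hre : ∀ z ∈ ball (0 : ℂ) R, 0 ≤ (f z).re) (hz : ‖z‖ < R) :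
    (f z).re * (R - ‖z‖) ≤ (f 0).re * (R + ‖z‖) ∧
      (f 0).re * (R - ‖z‖) ≤ (f z).re * (R + ‖z‖) := by
  have hR : 0 < R := (norm_nonneg z).trans_lt hz
  have main : ∀ ε > 0, ((f z).re + ε) * (R - ‖z‖) ≤ ((f 0).re + ε) * (R + ‖z‖) ∧
      ((f 0).re + ε) * (R - ‖z‖) ≤ ((f z).re + ε) * (R + ‖z‖) := by
    intro ε hε
    set a : ℝ := (f 0).re + ε with ha
    have h0 : (0 : ℂ) ∈ ball (0 : ℂ) R := by simpa using hR
    have ha0 : 0 < a := by linarith [hre 0 h0]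
    set F : ℂ → ℂ := fun ζ => f ζ + ε - (f 0).im * Complex.I with hF
    have hFd : DifferentiableOn ℂ F (ball 0 R) := by fun_prop
    have hFre : ∀ ζ, (F ζ).re = (f ζ).re + ε := fun ζ => by simp [hF]
    have hF0 : F 0 = a := by
      apply Complex.ext <;> simp [hF, ha]
    have hpos : ∀ ζ ∈ ball (0 : ℂ) R, 0 < (F ζ).re := fun ζ hζ => by
      rw [hFre]; linarith [hre ζ hζ]
    have hne : ∀ ζ ∈ ball (0 : ℂ) R, F ζ + a ≠ 0 := fun ζ hζ h => by
      have := congrArg Complex.re h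
      simp only [Complex.add_re, Complex.ofReal_re, Complex.zero_re] at this
      linarith [hpos ζ hζ]
    -- Cayley transform of the right half-plane sending F(0) = a to 0; the Schwarz lemma then
    -- applies. The shift by ε ensures a > 0.
    set W : ℂ → ℂ := fun ζ => (F ζ - a) / (F ζ + a) with hW
    have hWd : DifferentiableOn ℂ W (ball 0 R) :=
      (hFd.sub_const _).div (hFd.add_const _) hne
    have hW0 : W 0 = 0 := by simp [hW, hF0]
    have hWle : MapsTo W (ball 0 R) (closedBall (W 0) 1) := by
      intro ζ hζ
      rw [hW0, mem_closedBall_zero_iff, hW, norm_div,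
        div_le_one (norm_pos_iff.2 (hne ζ hζ))]
      refine le_of_sq_le_sq ?_ (norm_nonneg _)
      have := hpos ζ hζ
      simp only [← Complex.normSq_eq_norm_sq, Complex.normSq_apply, Complex.sub_re,
        Complex.sub_im, Complex.add_re, Complex.add_im, Complex.ofReal_re, Complex.ofReal_im]
      nlinarith
    have hzb : z ∈ ball (0 : ℂ) R := by simpa using hz
    have hS := Complex.dist_le_div_mul_dist_of_mapsTo_ball hWd hWle hzb
    rw [hW0, dist_zero_right, dist_zero_right, hW, norm_div, one_div, inv_mul_eq_div,
      div_le_div_iff₀ (norm_pos_iff.2 (hne z hzb)) hR] at hS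
    have hS2 : (‖F z - a‖ * R) ^ 2 ≤ (‖z‖ * ‖F z + a‖) ^ 2 := by gcongr
    rw [mul_pow, mul_pow, ← Complex.normSq_eq_norm_sq (F z - a),
      ← Complex.normSq_eq_norm_sq (F z + a)] at hS2
    simp only [Complex.normSq_apply, Complex.sub_re, Complex.sub_im, Complex.add_re,
      Complex.add_im, Complex.ofReal_re, Complex.ofReal_im] at hS2
    rw [← hFre z]
    set x := (F z).re
    set y := (F z).im
    have hx : 0 < x := hpos z hzb
    have hn := norm_nonneg z
    have hq : (x - a) ^ 2 * R ^ 2 ≤ (x + a) ^ 2 * ‖z‖ ^ 2 := by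
      have : 0 ≤ (R ^ 2 - ‖z‖ ^ 2) * y ^ 2 := by
        apply mul_nonneg _ (sq_nonneg _); nlinarith
      nlinarith
    have hq' : |(x - a) * R| ≤ |(x + a) * ‖z‖| := by
      apply sq_le_sq.1; nlinarith
    rw [abs_of_nonneg (by positivity : 0 ≤ (x + a) * ‖z‖)] at hq'
    obtain ⟨h1, h2⟩ := abs_le.1 hq'
    constructor <;> nlinarith
  have hcont : ∀ c d : ℝ, Filter.Tendsto (fun ε : ℝ => (c + ε) * d)
      (nhdsWithin 0 (Ioi 0)) (nhds (c * d)) := by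
    intro c d
    have : Continuous fun ε : ℝ => (c + ε) * d := by fun_prop
    simpa using (this.tendsto 0).mono_left nhdsWithin_le_nhds
  constructor
  · exact le_of_tendsto_of_tendsto (hcont _ _) (hcont _ _)
      (eventually_nhdsWithin_of_forall fun ε hε => (main ε hε).1)
  · exact le_of_tendsto_of_tendsto (hcont _ _) (hcont _ _)
      (eventually_nhdsWithin_of_forall fun ε hε => (main ε hε).2)

/-- A nowhere vanishing holomorphic function on a disk has a holomorphic logarithm. -/
lemma exists_holomorphic_log {R : ℝ} {g : ℂ → ℂ} (hR : 0 < R)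
    (hg : DifferentiableOn ℂ g (ball 0 R)) (hne : ∀ z ∈ ball (0 : ℂ) R, g z ≠ 0) :
    ∃ f : ℂ → ℂ, DifferentiableOn ℂ f (ball 0 R) ∧
      ∀ z ∈ ball (0 : ℂ) R, g z = Complex.exp (f z) := by
  have hq : DifferentiableOn ℂ (fun z => deriv g z / g z) (ball 0 R) :=
    (hg.deriv isOpen_ball).div hg hne
  obtain ⟨f, hf⟩ := hq.isExactOn_ball
  have h0 : (0 : ℂ) ∈ ball (0 : ℂ) R := by simpa using hR
  have hder : ∀ z ∈ ball (0 : ℂ) R,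
      HasDerivAt (fun z => g z * Complex.exp (-f z)) 0 z := by
    intro z hz
    have h1 := (hg.differentiableAt (isOpen_ball.mem_nhds hz)).hasDerivAt
    have h2 := h1.mul (hf z hz).neg.cexp
    refine h2.congr_deriv ?_
    have := hne z hz
    field_simp
    ring
  have hconst : ∀ z ∈ ball (0 : ℂ) R,
      g z * Complex.exp (-f z) = g 0 * Complex.exp (-f 0) := by
    intro z hz
    exact isOpen_ball.is_const_of_deriv_eq_zero (convex_ball _ _).isPreconnected
      (fun x hx => (hder x hx).differentiableAt.differentiableWithinAt)
      (fun x hx => (hder x hx).deriv) hz h0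
  refine ⟨fun z => f z + (Complex.log (g 0) - f 0), ?_, fun z hz => ?_⟩
  · exact DifferentiableOn.add_const _
      (fun x hx => (hf x hx).differentiableAt.differentiableWithinAt)
  · have h := hconst z hz
    rw [Complex.exp_neg, ← div_eq_mul_inv, div_eq_iff (Complex.exp_ne_zero _)] at h
    rw [h, Complex.exp_add, Complex.exp_sub, Complex.exp_log (hne 0 h0), Complex.exp_neg]
    field_simp

/-- Two-point Harnack inequality for the logarithm of a bounded zero-free holomorphic function. -/
lemma log_div_norm_le_of_ne_zero {r ρ M : ℝ} {g : ℂ → ℂ} {z₀ z : ℂ} (hr : 0 < r) (hrρ : r < ρ)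
    (hg : DifferentiableOn ℂ g (ball 0 ρ)) (hM : ∀ z ∈ ball (0 : ℂ) ρ, ‖g z‖ ≤ M)
    (hne : ∀ z, ‖z‖ ≤ (r + ρ) / 2 → g z ≠ 0) (hz₀ : ‖z₀‖ < r) (h₀ : 1 ≤ ‖g z₀‖) (hz : ‖z‖ < r) :
    M * Real.exp (-(16 * (ρ / (ρ - r)) ^ 2 * Real.log M)) ≤ ‖g z‖ := by
  have hρ : 0 < ρ := hr.trans hrρ
  have hd : 0 < ρ - r := sub_pos.2 hrρ
  set R := (r + ρ) / 2 with hR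
  have hsub : ball (0 : ℂ) R ⊆ ball 0 ρ := ball_subset_ball (by linarith)
  have hM1 : 1 ≤ M := h₀.trans (hM z₀ (by simpa using hz₀.trans hrρ))
  have hM0 : 0 < M := by linarith
  obtain ⟨f, hf, hfe⟩ := exists_holomorphic_log (R := R) (by linarith) (hg.mono hsub)
    (fun z hz => hne z (by simpa using (mem_ball_zero_iff.1 hz).le))
  have hnorm : ∀ z ∈ ball (0 : ℂ) R, ‖g z‖ = Real.exp (f z).re := fun z hz => by
    rw [hfe z hz, Complex.norm_exp]
  set u : ℂ → ℂ := fun z => Real.log M - f z with hu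
  have hud : DifferentiableOn ℂ u (ball 0 R) := by fun_prop
  have hure : ∀ z, (u z).re = Real.log M - (f z).re := fun z => by
    rw [hu, Complex.sub_re, Complex.ofReal_re]
  have hu0 : ∀ z ∈ ball (0 : ℂ) R, 0 ≤ (u z).re := fun z hz => by
    have h := hM z (hsub hz)
    rw [hnorm z hz, ← Real.le_log_iff_exp_le hM0] at h
    rw [hure]; linarith
  have hzR : ‖z‖ < R := by linarith
  have hz₀R : ‖z₀‖ < R := by linarith
  -- The two points are compared through the center, at the cost of a factor 4ρ/(ρ-r) each time.
  have H1 := (harnack_re hud hu0 hzR).1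
  have H2 := (harnack_re hud hu0 hz₀R).2
  have hz₀u : (u z₀).re ≤ Real.log M := by
    rw [hnorm z₀ (by simpa using hz₀R), Real.one_le_exp_iff] at h₀
    rw [hure]; linarith
  have p0 := hu0 0 (by simp; linarith)
  have pz := hu0 z (by simpa using hzR)
  have pz₀ := hu0 z₀ (by simpa using hz₀R)
  have e1 : (u z).re * ((ρ - r) / 2) ≤ (u 0).re * (2 * ρ) := by
    calc (u z).re * ((ρ - r) / 2) ≤ (u z).re * (R - ‖z‖) := by gcongr; linarith
      _ ≤ _ := H1
      _ ≤ _ := by gcongr; linarith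
  have e2 : (u 0).re * ((ρ - r) / 2) ≤ Real.log M * (2 * ρ) := by
    calc (u 0).re * ((ρ - r) / 2) ≤ (u 0).re * (R - ‖z₀‖) := by gcongr; linarith
      _ ≤ _ := H2
      _ ≤ Real.log M * (2 * ρ) := by
        have := Real.log_nonneg hM1
        gcongr; linarith
  have e3 : (u z).re ≤ 16 * (ρ / (ρ - r)) ^ 2 * Real.log M := by
    have : (u z).re * ((ρ - r) / 2) * ((ρ - r) / 2) ≤ Real.log M * (2 * ρ) * (2 * ρ) := by
      calc _ ≤ (u 0).re * (2 * ρ) * ((ρ - r) / 2) := by gcongr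
        _ = (u 0).re * ((ρ - r) / 2) * (2 * ρ) := by ring
        _ ≤ _ := by gcongr
    have e : 16 * (ρ / (ρ - r)) ^ 2 * Real.log M = 16 * ρ ^ 2 * Real.log M / (ρ - r) ^ 2 := by
      field_simp
    rw [e, le_div_iff₀ (by positivity)]
    nlinarith
  rw [hnorm z (by simpa using hzR)]
  nth_rewrite 1 [← Real.exp_log hM0]
  rw [← Real.exp_add, Real.exp_le_exp]
  rw [hure] at e3
  linarith

/-! ### Averaging over E -/

lemma lintegral_inv_enorm_ball_le (s : ℝ) :
    ∫⁻ z : ℂ, (ball (0 : ℂ) s).indicator (fun z => ‖z‖ₑ⁻¹) z ≤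
      ENNReal.ofReal s * ENNReal.ofReal (2 * Real.pi) := by
  rw [← Complex.lintegral_comp_polarCoord_symm]
  calc _ ≤ ∫⁻ p in polarCoord.target,
        (Ioo (0 : ℝ) s ×ˢ Ioo (-Real.pi) Real.pi).indicator (fun _ => (1 : ℝ≥0∞)) p := by
        refine setLIntegral_mono' (isOpen_Ioi.prod isOpen_Ioo).measurableSet fun p hp => ?_
        obtain ⟨hp1, hp2⟩ := hp
        have hp1 : 0 < p.1 := hp1
        have hn : ‖Complex.polarCoord.symm p‖ = p.1 := by
          rw [Complex.norm_polarCoord_symm, abs_of_pos hp1]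
        by_cases hps : p.1 < s
        · rw [indicator_of_mem (by rwa [mem_ball_zero_iff, hn]),
            indicator_of_mem (show p ∈ Ioo (0 : ℝ) s ×ˢ Ioo (-Real.pi) Real.pi from
              ⟨⟨hp1, hps⟩, hp2⟩), ← ofReal_norm, hn, smul_eq_mul,
            ENNReal.mul_inv_cancel (by simpa using hp1) ENNReal.ofReal_ne_top]
        · rw [indicator_of_notMem (by rwa [mem_ball_zero_iff, hn])]
          simp
    _ ≤ ∫⁻ p : ℝ × ℝ,
        (Ioo (0 : ℝ) s ×ˢ Ioo (-Real.pi) Real.pi).indicator (fun _ => (1 : ℝ≥0∞)) p :=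
        setLIntegral_le_lintegral _ _
    _ = _ := by
        rw [lintegral_indicator (measurableSet_Ioo.prod measurableSet_Ioo), setLIntegral_one,
          Measure.volume_eq_prod, Measure.prod_prod, Real.volume_Ioo, Real.volume_Ioo]
        congr 2 <;> ring

/-- Outside D(w,s) the integrand is at most 1, contributing at most |E|; the disk itself contributes
at most 2πs² = 2|E|. -/
lemma setLIntegral_inv_enorm_sub_le {E : Set ℂ} {s : ℝ} (hs : 0 < s)
    (hE : volume E = ENNReal.ofReal (Real.pi * s ^ 2)) (w : ℂ) :
    ∫⁻ z in E, ENNReal.ofReal s * ‖z - w‖ₑ⁻¹ ≤ 3 * volume E := by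
  have hpt : ∀ z : ℂ, ENNReal.ofReal s * ‖z - w‖ₑ⁻¹ ≤
      1 + ENNReal.ofReal s * (ball (0 : ℂ) s).indicator (fun z => ‖z‖ₑ⁻¹) (z - w) := by
    intro z
    by_cases hz : z - w ∈ ball (0 : ℂ) s
    · rw [indicator_of_mem hz]; exact le_add_self
    · rw [indicator_of_notMem hz, mul_zero, add_zero, ← div_eq_mul_inv]
      refine ENNReal.div_le_of_le_mul ?_
      rw [one_mul, ← ofReal_norm]
      exact ENNReal.ofReal_le_ofReal (by simpa using hz)
  calc _ ≤ ∫⁻ z in E,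
        (1 + ENNReal.ofReal s * (ball (0 : ℂ) s).indicator (fun z => ‖z‖ₑ⁻¹) (z - w)) :=
        lintegral_mono hpt
    _ = volume E + ENNReal.ofReal s *
        ∫⁻ z in E, (ball (0 : ℂ) s).indicator (fun z => ‖z‖ₑ⁻¹) (z - w) := by
        rw [lintegral_add_left measurable_const, setLIntegral_one,
          lintegral_const_mul' _ _ ENNReal.ofReal_ne_top]
    _ ≤ volume E + ENNReal.ofReal s *
        ∫⁻ z, (ball (0 : ℂ) s).indicator (fun z => ‖z‖ₑ⁻¹) (z - w) := by
        gcongr _ + _ * ?_; exact setLIntegral_le_lintegral _ _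
    _ = volume E + ENNReal.ofReal s *
        ∫⁻ z, (ball (0 : ℂ) s).indicator (fun z => ‖z‖ₑ⁻¹) z := by
        rw [lintegral_sub_right_eq_self (fun z => (ball (0 : ℂ) s).indicator (fun z => ‖z‖ₑ⁻¹) z)]
    _ ≤ volume E + ENNReal.ofReal s * (ENNReal.ofReal s * ENNReal.ofReal (2 * Real.pi)) := by
        gcongr; exact lintegral_inv_enorm_ball_le s
    _ = 3 * volume E := by
        have : ENNReal.ofReal s * (ENNReal.ofReal s * ENNReal.ofReal (2 * Real.pi)) =
            2 * volume E := by
          rw [hE, ← ENNReal.ofReal_mul hs.le, ← ENNReal.ofReal_mul hs.le,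
            ← ENNReal.ofReal_ofNat 2, ← ENNReal.ofReal_mul (by norm_num)]
          congr 1; ring
        rw [this]; ring

/-- Among the points of a set with the area of a disk of radius `s`, one is on average at distance
at least comparable to `s` from finitely many given points. -/
lemma exists_mem_sum_div_norm_sub_le {E : Set ℂ} {s : ℝ} (hs : 0 < s)
    (hE : volume E = ENNReal.ofReal (Real.pi * s ^ 2)) {n : ℕ} (w : Fin n → ℂ) :
    ∃ z ∈ E, (∀ j, z ≠ w j) ∧ ∑ j, s / ‖z - w j‖ ≤ 3 * n := by
  have hE0 : volume E ≠ 0 := by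
    rw [hE]; simpa using by positivity
  have hEt : volume E ≠ ∞ := by rw [hE]; exact ENNReal.ofReal_ne_top
  have hmeas : ∀ j, Measurable fun z : ℂ => ENNReal.ofReal s * ‖z - w j‖ₑ⁻¹ := fun j => by
    fun_prop
  obtain ⟨z, hzE, hz⟩ := exists_le_setLAverage (μ := volume) (s := E)
    (f := fun z => ∑ j, ENNReal.ofReal s * ‖z - w j‖ₑ⁻¹) hE0 hEt
    (Finset.measurable_sum _ fun j _ => hmeas j).aemeasurable
  have hz' : ∑ j, ENNReal.ofReal s * ‖z - w j‖ₑ⁻¹ ≤ ENNReal.ofReal (3 * n) := by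
    refine hz.trans ?_
    rw [setLAverage_eq]
    refine ENNReal.div_le_of_le_mul ?_
    rw [lintegral_finsetSum _ fun j _ => hmeas j]
    calc _ ≤ ∑ _j : Fin n, 3 * volume E :=
          Finset.sum_le_sum fun j _ => setLIntegral_inv_enorm_sub_le hs hE (w j)
      _ = _ := by
        rw [Finset.sum_const, Finset.card_univ, Fintype.card_fin, nsmul_eq_mul, ← mul_assoc,
          ENNReal.ofReal_mul (by norm_num), ENNReal.ofReal_natCast, ENNReal.ofReal_ofNat,
          mul_comm (n : ℝ≥0∞)]
  -- In `ℝ≥0∞` a coincidence would make the sum infinite; in `ℝ` division by zero would hide it.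
  have hne : ∀ j, z ≠ w j := by
    rintro j rfl
    have h1 := (Finset.single_le_sum (f := fun i => ENNReal.ofReal s * ‖w j - w i‖ₑ⁻¹)
      (fun i _ => zero_le) (Finset.mem_univ j)).trans hz'
    rw [sub_self, enorm_zero, ENNReal.inv_zero, ENNReal.mul_top (by simpa using hs)] at h1
    exact ENNReal.ofReal_ne_top (top_le_iff.1 h1)
  refine ⟨z, hzE, hne, ?_⟩
  have hterm : ∀ j, ENNReal.ofReal s * ‖z - w j‖ₑ⁻¹ = ENNReal.ofReal (s / ‖z - w j‖) := fun j => by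
    have hp : 0 < ‖z - w j‖ := norm_pos_iff.2 (sub_ne_zero.2 (hne j))
    rw [← ofReal_norm, ← ENNReal.ofReal_inv_of_pos hp, ← ENNReal.ofReal_mul hs.le, div_eq_mul_inv]
  simp_rw [hterm] at hz'
  rw [← ENNReal.ofReal_sum_of_nonneg fun j _ => by positivity] at hz'
  exact (ENNReal.ofReal_le_ofReal_iff (by positivity)).1 hz'

/-! ### Combining the estimates -/

/-- A bounded holomorphic function on a disk is not small everywhere on a set of given area in a
smaller concentric disk of comparable radius. -/
lemma exists_mem_le_norm {r ρ M s : ℝ} {φ : ℂ → ℂ} {z₀ : ℂ} {E : Set ℂ} (hr : 0 < r)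
    (hrρ : r < ρ) (hρr : ρ ≤ 2 * r) (hφ : DifferentiableOn ℂ φ (ball 0 ρ))
    (hM : ∀ z ∈ ball (0 : ℂ) ρ, ‖φ z‖ ≤ M) (hz₀ : ‖z₀‖ < r) (h₀ : 1 ≤ ‖φ z₀‖)
    (hEr : E ⊆ ball 0 r) (hs : 0 < s) (hsr : s ≤ r)
    (hE : volume E = ENNReal.ofReal (Real.pi * s ^ 2)) :
    ∃ z ∈ E, M * Real.exp (-(16 * (ρ / (ρ - r)) ^ 2 * Real.log M *
      (3 + Real.log (4 * r / s)))) ≤ ‖φ z‖ := by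
  obtain ⟨n, w, g, hn, hw, hg, hgM, heq, hne⟩ :=
    exists_blaschke_factorization hr hrρ hφ hM hz₀ h₀
  obtain ⟨z, hzE, hzw, hsum⟩ := exists_mem_sum_div_norm_sub_le hs hE w
  have hρ : 0 < ρ := hr.trans hrρ
  have hzr : ‖z‖ < r := by simpa using hEr hzE
  have hz₀ρ : z₀ ∈ ball (0 : ℂ) ρ := by simpa using hz₀.trans hrρ
  have hM0 : 0 < M := by linarith [h₀.trans (hM z₀ hz₀ρ)]
  have hg₀ : 1 ≤ ‖g z₀‖ := by
    have hb : ∏ j, ‖blaschkeFactor ρ (w j) z₀‖ ≤ 1 :=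
      Finset.prod_le_one (fun j _ => norm_nonneg _) fun j _ =>
        (norm_blaschkeFactor_le_exp hr hrρ (hw j) hz₀.le).trans
          (Real.exp_le_one_iff.2 (neg_nonpos.2 (by positivity)))
    rw [heq z₀ hz₀ρ, norm_mul, norm_prod] at h₀
    exact h₀.trans (mul_le_of_le_one_left (norm_nonneg _) hb)
  have hgz := log_div_norm_le_of_ne_zero hr hrρ hg hgM hne hz₀ hg₀ hzr
  have hfac : ∀ j, Real.exp (1 - s / ‖z - w j‖ - Real.log (4 * r / s)) ≤
      ‖blaschkeFactor ρ (w j) z‖ := by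
    intro j
    have hp : 0 < ‖z - w j‖ := norm_pos_iff.2 (sub_ne_zero.2 (hzw j))
    have hwρ : ‖w j‖ < ρ := by linarith [hw j]
    refine le_trans ?_ (norm_sub_div_le_norm_blaschkeFactor hwρ (hzr.trans hrρ).le)
    -- ln x ≤ x - 1 turns the bound on the sum into one on the product.
    have h1 : Real.exp (1 - s / ‖z - w j‖) ≤ ‖z - w j‖ / s := by
      rw [← Real.le_log_iff_exp_le (by positivity)]
      have := Real.log_le_sub_one_of_pos (show 0 < s / ‖z - w j‖ by positivity)
      rw [← inv_div s, Real.log_inv]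
      linarith
    rw [Real.exp_sub, Real.exp_log (by positivity)]
    calc _ ≤ ‖z - w j‖ / s / (4 * r / s) := by gcongr
      _ = ‖z - w j‖ / (4 * r) := by field_simp
      _ ≤ _ := div_le_div_of_nonneg_left hp.le (by positivity) (by linarith)
  have hl : 0 ≤ Real.log (4 * r / s) :=
    Real.log_nonneg (by rw [le_div_iff₀ hs]; linarith)
  refine ⟨z, hzE, ?_⟩
  rw [heq z (by simpa using hzr.trans hrρ), norm_mul, norm_prod]
  set N := 16 * (ρ / (ρ - r)) ^ 2 * Real.log M with hN
  have hprod : Real.exp (-(N * (2 + Real.log (4 * r / s)))) ≤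
      ∏ j, ‖blaschkeFactor ρ (w j) z‖ := by
    calc _ ≤ Real.exp (∑ j, (1 - s / ‖z - w j‖ - Real.log (4 * r / s))) := by
          rw [Real.exp_le_exp]
          simp only [Finset.sum_sub_distrib, Finset.sum_const, Finset.card_univ, Fintype.card_fin,
            nsmul_eq_mul]
          nlinarith [mul_le_mul_of_nonneg_right hn (show 0 ≤ 2 + Real.log (4 * r / s) by linarith)]
      _ = ∏ j, Real.exp (1 - s / ‖z - w j‖ - Real.log (4 * r / s)) := Real.exp_sum _ _
      _ ≤ _ := Finset.prod_le_prod (fun j _ => (Real.exp_pos _).le) fun j _ => hfac j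
  calc _ = Real.exp (-(N * (2 + Real.log (4 * r / s)))) * (M * Real.exp (-N)) := by
        rw [mul_left_comm, ← Real.exp_add]
        congr 2; ring
    _ ≤ _ := by gcongr

theorem lemma2 :
    ∃ c c'' : ℝ, 0 < c ∧ 0 < c'' ∧
      ∀ r ρ : ℝ, 0 < r → r < ρ →
        ∃ η : ℝ, 0 < η ∧
          η ≤ c'' * (ρ ^ 4 / (ρ - r) ^ 4) * max 1 (Real.log (ρ / (ρ - r))) ∧
          ∀ (φ : ℂ → ℂ) (M : ℝ) (E : Set ℂ) (z₀ : ℂ),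
            AnalyticOnNhd ℂ φ (Metric.ball 0 ρ) →
            IsLUB ((fun z => ‖φ z‖) '' Metric.ball 0 ρ) M →
            E ⊆ Metric.ball 0 r →
            MeasureTheory.NullMeasurableSet E MeasureTheory.volume →
            0 < MeasureTheory.volume E →
            z₀ ∈ Metric.ball 0 r →
            1 ≤ ‖φ z₀‖ →
            sSup ((fun z => ‖φ z‖) '' Metric.ball 0 r) ≤
              (c * r ^ 2 / MeasureTheory.volume.real E) ^ (η * Real.log M) *
                sSup ((fun z => ‖φ z‖) '' E) := by
  -- The base is e³(4r/s)², as |E| = πs².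
  refine ⟨16 * Real.pi * Real.exp 3, 64, by positivity, by norm_num, fun r ρ hr hrρ => ?_⟩
  have hρ : 0 < ρ := hr.trans hrρ
  have hd : 0 < ρ - r := sub_pos.2 hrρ
  have hq : 1 ≤ ρ / (ρ - r) := by rw [le_div_iff₀ hd]; linarith
  -- 64 = 16·4, the 4 being lost on passing to ρ₁. The square suffices: neither the fourth power nor
  -- the logarithm is needed.
  refine ⟨64 * (ρ / (ρ - r)) ^ 2, by positivity, ?_, ?_⟩
  · rw [← div_pow]
    calc 64 * (ρ / (ρ - r)) ^ 2 ≤ 64 * (ρ / (ρ - r)) ^ 4 * 1 := by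
          rw [mul_one]; gcongr; norm_num
      _ ≤ _ := by gcongr; exact le_max_left _ _
  intro φ M E z₀ hφ hM hEr _ hE0 hz₀ h₀
  set ρ₁ := min ρ (2 * r) with hρ₁
  have hrρ₁ : r < ρ₁ := lt_min hrρ (by linarith)
  have hρ₁r : ρ₁ ≤ 2 * r := min_le_right _ _
  have hsub : ball (0 : ℂ) ρ₁ ⊆ ball 0 ρ := ball_subset_ball (min_le_left _ _)
  have hbd : ∀ z ∈ ball (0 : ℂ) ρ, ‖φ z‖ ≤ M := fun z hz => hM.1 (mem_image_of_mem _ hz)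
  have hrsub : ball (0 : ℂ) r ⊆ ball 0 ρ := ball_subset_ball hrρ.le
  have hM1 : 1 ≤ M := h₀.trans (hbd z₀ (hrsub hz₀))
  have hlogM := Real.log_nonneg hM1
  have hEvol : volume E ≤ ENNReal.ofReal (Real.pi * r ^ 2) := by
    refine (measure_mono hEr).trans_eq ?_
    rw [Complex.volume_ball, ENNReal.ofReal_mul Real.pi_pos.le, ENNReal.ofReal_pow hr.le, mul_comm,
      ← ENNReal.ofReal_coe_nnreal, NNReal.coe_real_pi]
  have hEt : volume E ≠ ∞ := (hEvol.trans_lt ENNReal.ofReal_lt_top).ne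
  have hV0 : 0 < volume.real E := ENNReal.toReal_pos hE0.ne' hEt
  set s := √(volume.real E / Real.pi) with hs
  have hs0 : 0 < s := Real.sqrt_pos.2 (by positivity)
  have hVs : volume.real E = Real.pi * s ^ 2 := by
    rw [hs, Real.sq_sqrt (by positivity)]; field_simp
  have hVs' : volume E = ENNReal.ofReal (Real.pi * s ^ 2) := by
    rw [← hVs, ofReal_measureReal hEt]
  have hsr : s ≤ r := by
    rw [hVs', ENNReal.ofReal_le_ofReal_iff (by positivity)] at hEvol
    exact le_of_sq_le_sq (le_of_mul_le_mul_left hEvol Real.pi_pos) hr.le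
  obtain ⟨z, hzE, hz⟩ := exists_mem_le_norm hr hrρ₁ hρ₁r (hφ.differentiableOn.mono hsub)
    (fun z hz => hbd z (hsub hz)) (by simpa using hz₀) h₀ hEr hs0 hsr hVs'
  have hl : 0 ≤ Real.log (4 * r / s) :=
    Real.log_nonneg (by rw [le_div_iff₀ hs0]; linarith)
  have hbase : Real.log (16 * Real.pi * Real.exp 3 * r ^ 2 / volume.real E) =
      3 + 2 * Real.log (4 * r / s) := by
    have : 16 * Real.pi * Real.exp 3 * r ^ 2 / volume.real E =
        Real.exp 3 * (4 * r / s) ^ 2 := by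
      rw [hVs]; field_simp; ring
    rw [this, Real.log_mul (by positivity) (by positivity), Real.log_exp, Real.log_pow]
    push_cast; ring
  have hratio : (ρ₁ / (ρ₁ - r)) ^ 2 ≤ 4 * (ρ / (ρ - r)) ^ 2 := by
    have h1 : ρ₁ / (ρ₁ - r) ≤ 2 * (ρ / (ρ - r)) := by
      rcases min_choice ρ (2 * r) with h | h
      · rw [hρ₁, h]; linarith
      · rw [hρ₁, h]
        have : 2 * r / (2 * r - r) = 2 := by field_simp; ring
        rw [this]; linarith
    have h2 : 0 ≤ ρ₁ / (ρ₁ - r) := div_nonneg (by linarith) (by linarith)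
    calc _ ≤ (2 * (ρ / (ρ - r))) ^ 2 := by gcongr
      _ = _ := by ring
  have hexp : 16 * (ρ₁ / (ρ₁ - r)) ^ 2 * Real.log M * (3 + Real.log (4 * r / s)) ≤
      Real.log (16 * Real.pi * Real.exp 3 * r ^ 2 / volume.real E) *
        (64 * (ρ / (ρ - r)) ^ 2 * Real.log M) := by
    rw [hbase]
    calc _ ≤ 16 * (4 * (ρ / (ρ - r)) ^ 2) * Real.log M * (3 + 2 * Real.log (4 * r / s)) := by
          gcongr; linarith
      _ = _ := by ring
  have hbdd : BddAbove ((fun z => ‖φ z‖) '' E) :=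
    ⟨M, by rintro _ ⟨x, hx, rfl⟩; exact hbd x (hrsub (hEr hx))⟩
  have hzsup : ‖φ z‖ ≤ sSup ((fun z => ‖φ z‖) '' E) := le_csSup hbdd (mem_image_of_mem _ hzE)
  calc sSup ((fun z => ‖φ z‖) '' ball 0 r) ≤ M :=
        csSup_le (Set.Nonempty.image _ ⟨z₀, hz₀⟩)
          (by rintro _ ⟨x, hx, rfl⟩; exact hbd x (hrsub hx))
    _ ≤ Real.exp (16 * (ρ₁ / (ρ₁ - r)) ^ 2 * Real.log M * (3 + Real.log (4 * r / s))) *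
        ‖φ z‖ := by
        rw [Real.exp_neg, ← div_eq_mul_inv, div_le_iff₀ (Real.exp_pos _)] at hz
        linarith
    _ ≤ _ := by
        rw [Real.rpow_def_of_pos (by positivity)]
        gcongr
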